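/- Let $X$ be a locally compact Hausdorff space, equipped with its Borel $\sigma$-algebra. Let $C_b$ be the space of bounded continuous functions $f : X \to \mathbb{R}$ and $C_0 \subset C_b$ the subspace of those that vanish at infinity. Let $\mathcal{M}$ be the set of finite signed regular Borel measures on $X$ (for every Borel set $A$ and every $\varepsilon > 0$ there are a compact $K \subset A$ and an open $O \supset A$ with $|\mu(A) - \mu(K)| \le \varepsilon$ and $|\mu(O) - \mu(A)| \le \varepsilon$), and let $\mathcal{P} \subset \mathcal{M}$ be the set of regular Borel probability measures. Let $k : X \times X \to \mathbb{R}$ be a kernel (a symmetric positive definite function) with reproducing kernel Hilbert space $\mathcal{H}_k$. For $\mu, \nu \in \mathcal{M}$ write $f_\mu = \int_X k(\cdot, x)\, d\mu(x) \in \mathcal{H}_k$ (Bochner integral) for the kernel mean embedding, and $\|\mu - \nu\|_k = \|f_\mu - f_\nu\|_{\mathcal{H}_k}$ for the maximum mean discrepancy (MMD); for a function $f$ write $\mu(f) = \int_X f\, d\mu$. Assume that $\mathcal{H}_k \subset C_0$ and that $k$ is integrally strictly positive definite (ISPD), i.e. for all $\mu, \nu \in \mathcal{M}$, $\|\mu -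 \nu\|_k = 0$ implies $\mu = \nu$. (a) If $k$ is continuous on $X \times X$, then for every sequence or net $(P_\alpha)$ in $\mathcal{P}$ (more generally, every family in $\mathcal{P}$ with convergence taken along a filter on the index set) and every $P \in \mathcal{P}$, the following are equivalent: 1. $\|P_\alpha - P\|_k \to 0$ (convergence in MMD, i.e. in the strong RKHS topology); 2. $P_\alpha(f) \to P(f)$ for all $f \in \mathcal{H}_k$ (weak RKHS convergence); 3. $P_\alpha(f) \to P(f)$ for all $f \in C_0$ (vague convergence); 4. $P_\alpha(f) \to P(f)$ for all $f \in C_b$ (weak convergence). (b) Conversely, if 4 implies 1 for all sequences $(P_n)$ in $\mathcal{P}$ and all $P \in \mathcal{P}$ (in particular, if 4 implies 1 for all nets in $\mathcal{P}$ and all $P \in \mathcal{P}$), then $k$ is continuous on $X \times X$. -/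

import Mathlib

open MeasureTheory Filter Topology
open scoped ZeroAtInfty BoundedContinuousFunction

/-- A (real, reproducing) kernel on `X`: a symmetric positive definite function of two variables. -/
structure PDKernel (X : Type*) where
  /-- The underlying function of two variables. -/
  toFun : X → X → ℝ
  symm' : ∀ x y, toFun x y = toFun y x
  nonneg' : ∀ (s : Finset X) (c : X → ℝ), 0 ≤ ∑ x ∈ s, ∑ y ∈ s, c x * c y * toFun x y

namespace PDKernel

section Algebraic

variable {X : Type*} (k : PDKernel X)

instance : CoeFun (PDKernel X) (fun _ => X → X → ℝ) := ⟨PDKernel.toFun⟩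

/-- The kernel as a matrix of operators on the one-dimensional Hilbert space `ℝ`: the entry at
`(x, y)` is multiplication by `k x y`. This is the format of kernels in Mathlib's `RKHS`. -/
noncomputable def matrix : Matrix X X (ℝ →L[ℝ] ℝ) :=
  Matrix.of fun x y => k x y • ContinuousLinearMap.id ℝ ℝ

theorem matrix_apply (x y : X) (t : ℝ) : k.matrix x y t = k x y * t := by
  simp [matrix]

theorem matrix_posSemidef : k.matrix.PosSemidef := by
  have h := (RKHS.posSemidef_tfae (K := k.matrix)).out 0 2
  refine h.2 ⟨?_, fun v => ?_⟩
  · ext x y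
    simp [matrix, Matrix.conjTranspose_apply, ContinuousLinearMap.star_eq_adjoint,
      ContinuousLinearMap.adjoint_id, k.symm' y x]
  · have := k.nonneg' v.support v
    simp only [Finsupp.sum, matrix_apply, RCLike.re_to_real]
    refine this.trans_eq ?_
    refine Finset.sum_congr rfl fun x _ => Finset.sum_congr rfl fun y _ => ?_
    simp [k.symm' x y]
    ring

instance : Fact k.matrix.PosSemidef := ⟨k.matrix_posSemidef⟩

/-- The reproducing kernel Hilbert space `H_k` of the kernel `k`. -/
def Hilbert : Type _ := RKHS.OfKernel k.matrix

noncomputable instance : NormedAddCommGroup k.Hilbert :=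
  inferInstanceAs (NormedAddCommGroup (RKHS.OfKernel k.matrix))

noncomputable instance : InnerProductSpace ℝ k.Hilbert :=
  inferInstanceAs (InnerProductSpace ℝ (RKHS.OfKernel k.matrix))

instance : CompleteSpace k.Hilbert :=
  inferInstanceAs (CompleteSpace (RKHS.OfKernel k.matrix))

noncomputable instance : RKHS ℝ k.Hilbert X ℝ :=
  inferInstanceAs (RKHS ℝ (RKHS.OfKernel k.matrix) X ℝ)

theorem kernel_hilbert : RKHS.kernel k.Hilbert = k.matrix :=
  RKHS.OfKernel.kernel_ofKernel

/-- The canonical feature `k(·, x)`, as an element of `H_k`. -/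
noncomputable def feature (x : X) : k.Hilbert := RKHS.kerFun k.Hilbert x 1

theorem feature_apply (x y : X) : k.feature x y = k y x := by
  rw [feature, RKHS.kerFun_apply, kernel_hilbert, matrix_apply, mul_one]

theorem inner_feature (f : k.Hilbert) (x : X) : inner ℝ f (k.feature x) = f x := by
  simp [feature]

end Algebraic

section Embedding

variable {X : Type*} [MeasurableSpace X] (k : PDKernel X)

/-- The kernel mean embedding `f_μ = ∫ k(·, x) dμ(x) ∈ H_k` of a finite signed measure `μ`: a
Bochner integral with values in `H_k`. -/
noncomputable def kme (μ : SignedMeasure X) : k.Hilbert := ∫ᵛ x, k.feature x ∂<•μ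

/-- The maximum mean discrepancy `d_k(μ, ν) = ‖f_μ - f_ν‖`. -/
noncomputable def mmd (μ ν : SignedMeasure X) : ℝ := ‖k.kme μ - k.kme ν‖

end Embedding

end PDKernel

/-- Regularity of a finite signed Borel measure. -/
def SignedMeasureRegular {X : Type*} [TopologicalSpace X] [MeasurableSpace X]
    (μ : SignedMeasure X) : Prop :=
  ∀ A : Set X, MeasurableSet A → ∀ ε : ℝ, 0 < ε →
    ∃ K O : Set X, IsCompact K ∧ IsOpen O ∧ K ⊆ A ∧ A ⊆ O ∧
      |μ A - μ K| ≤ ε ∧ |μ O - μ A| ≤ ε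

namespace PDKernel

variable {X : Type*} [TopologicalSpace X] (k : PDKernel X)

/-- `k` is integrally strictly positive definite: its MMD separates all finite, signed, regular
Borel measures. (A measure `μ` for which `x ↦ k(·, x)` is not Bochner integrable gets the value
`kme μ = 0 = kme 0`, so that the separation also forces all embeddings to be well-defined.) -/
def IsISPD [MeasurableSpace X] : Prop :=
  ∀ μ ν : SignedMeasure X, SignedMeasureRegular μ → SignedMeasureRegular ν →
    k.mmd μ ν = 0 → μ = ν

/-- `H_k ⊂ C_0`: each function in the RKHS is continuous and vanishes at infinity. -/
def RKHSSubsetC0 : Prop :=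
  ∀ f : k.Hilbert, ∃ g : C₀(X, ℝ), ∀ x, g x = f x

end PDKernel

open scoped CompactlySupported

/-! (a) Pairing with `f` gives 1 → 2. For 2 → 3, vague compactness yields a limit `ν` along each
ultrafilter; since `H_k ⊂ C_0`, `ν` and `Q` agree on `H_k`, and ISPD forces `ν = Q`. As `Q` has mass
one, no mass escapes to infinity, so compactly supported cutoffs (`tendsto_integral_of_cutoff`) give
both 3 → 4 and 3 → 1. In 3 → 1 the cut-off embeddings stay in a norm-compact convex set, where weak
convergence is norm convergence.

(b) Dirac measures turn the hypothesis into sequential continuity of `k.feature`. As `X` need not be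
first countable, more is needed: a discontinuity at `x₀` would be seen by a sequence whose feature
differences are asymptotically orthogonal, hence weakly null (`exists_seq_tendsto_inner_zero`).
Compactness and injectivity of the feature map then force that sequence to converge to `x₀`, a
contradiction. -/

theorem tendsto_of_forall_approx {ι E : Type*} [SeminormedAddCommGroup E] {l : Filter ι}
    {a : ι → E} {A : E}
    (h : ∀ ε : ℝ, 0 < ε → ∃ (b : ι → E) (B : E),
      (∀ᶠ i in l, ‖a i - b i‖ ≤ ε) ∧ ‖A - B‖ ≤ ε ∧ Tendsto b l (𝓝 B)) :
    Tendsto a l (𝓝 A) := by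
  rw [Metric.tendsto_nhds]
  intro ε hε
  obtain ⟨b, B, hab, hAB, hb⟩ := h (ε / 4) (by positivity)
  filter_upwards [hab, Metric.tendsto_nhds.1 hb (ε / 4) (by positivity)] with i h1 h2
  rw [dist_eq_norm] at h2 ⊢
  calc ‖a i - A‖ = ‖(a i - b i) + (b i - B) - (A - B)‖ := by congr 1; abel
    _ ≤ ‖a i - b i‖ + ‖b i - B‖ + ‖A - B‖ :=
        (norm_sub_le _ _).trans (by gcongr; exact norm_add_le _ _)
    _ < ε := by linarith

section Approximation

variable {X : Type*} [TopologicalSpace X]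

/-- Soft thresholding approximates a function vanishing at infinity by compactly supported ones. -/
theorem ZeroAtInftyContinuousMap.exists_compactlySupported_approx [T2Space X] (f : C₀(X, ℝ)) {ε : ℝ}
    (hε : 0 < ε) : ∃ g : C_c(X, ℝ), ∀ x, ‖f x - g x‖ ≤ ε := by
  have hev : ∀ᶠ x in cocompact X, |f x| < ε := by
    simpa [Real.dist_eq] using Metric.tendsto_nhds.1 (zero_at_infty f) ε hε
  obtain ⟨K, hK, hKf⟩ := mem_cocompact.1 hev
  refine ⟨⟨⟨fun x => max (f x - ε) 0 - max (-f x - ε) 0, by fun_prop⟩, ?_⟩, fun x => ?_⟩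
  · refine HasCompactSupport.intro hK fun x hx => ?_
    have h1 : |f x| < ε := hKf hx
    rw [abs_lt] at h1
    change max (f x - ε) 0 - max (-f x - ε) 0 = 0
    rw [max_eq_right (by linarith), max_eq_right (by linarith), sub_zero]
  · change |f x - (max (f x - ε) 0 - max (-f x - ε) 0)| ≤ ε
    rw [abs_le]
    rcases max_cases (f x - ε) 0 with h | h <;> rcases max_cases (-f x - ε) 0 with h' | h' <;>
      constructor <;> linarith [h.1, h.2, h'.1, h'.2]

theorem exists_compactlySupported_eq_one_on [T2Space X] [LocallyCompactSpace X] {K : Set X}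
    (hK : IsCompact K) :
    ∃ φ : C_c(X, ℝ), (∀ x ∈ K, φ x = 1) ∧ ∀ x, 0 ≤ φ x ∧ φ x ≤ 1 := by
  obtain ⟨f, hf1, -, hfc, hf⟩ := exists_continuous_one_zero_of_isCompact hK isClosed_empty
    (Set.disjoint_empty K)
  exact ⟨⟨f, hfc⟩, fun x hx => hf1 hx, hf⟩

end Approximation

section Regular

variable {X : Type*} [TopologicalSpace X] [T2Space X] [MeasurableSpace X] [BorelSpace X]

theorem MeasureTheory.Measure.Regular.signedMeasureRegular (μ : Measure X) [IsFiniteMeasure μ]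
    [μ.Regular] : SignedMeasureRegular μ.toSignedMeasure := by
  intro A hA ε hε
  obtain ⟨K, hKA, hK, hμK⟩ := hA.exists_isCompact_lt_add (μ := μ) (measure_ne_top μ A)
    (ENNReal.ofReal_pos.2 hε).ne'
  obtain ⟨O, hAO, hO, hμO⟩ := A.exists_isOpen_lt_add (μ := μ) (measure_ne_top μ A)
    (ENNReal.ofReal_pos.2 hε).ne'
  refine ⟨K, O, hK, hO, hKA, hAO, ?_, ?_⟩
  · rw [Measure.toSignedMeasure_apply_measurable hA,
      Measure.toSignedMeasure_apply_measurable hK.measurableSet,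
      abs_of_nonneg (sub_nonneg.2 (measureReal_mono hKA)), sub_le_iff_le_add']
    have := ENNReal.toReal_mono (by finiteness) hμK.le
    rwa [ENNReal.toReal_add (by finiteness) (by finiteness), ENNReal.toReal_ofReal hε.le] at this
  · rw [Measure.toSignedMeasure_apply_measurable hA,
      Measure.toSignedMeasure_apply_measurable hO.measurableSet,
      abs_of_nonneg (sub_nonneg.2 (measureReal_mono hAO)), sub_le_iff_le_add']
    have := ENNReal.toReal_mono (by finiteness) hμO.le
    rwa [ENNReal.toReal_add (by finiteness) (by finiteness), ENNReal.toReal_ofReal hε.le] at this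

theorem MeasureTheory.Measure.regular_dirac (x : X) : (Measure.dirac x).Regular where
  lt_top_of_isCompact := fun _ _ => measure_lt_top _ _
  outerRegular := by
    intro A hA r hr
    by_cases hx : x ∈ A
    · exact ⟨Set.univ, Set.subset_univ _, isOpen_univ, by simpa [hx] using hr⟩
    · refine ⟨{x}ᶜ, fun y hy => ?_, isOpen_compl_singleton, ?_⟩
      · rintro rfl
        exact hx hy
      · simpa using pos_of_gt hr
  innerRegular := by
    intro U hU r hr
    have hx : x ∈ U := by
      by_contra hx
      simp [hU.measurableSet, hx] at hr
    exact ⟨{x}, by simpa using hx, isCompact_singleton, by simpa [hx] using hr⟩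

end Regular

section ZeroAtInfty

variable {X : Type*} [TopologicalSpace X] [MeasurableSpace X] [BorelSpace X]

theorem integrable_zeroAtInfty (f : C₀(X, ℝ)) (μ : Measure X) [IsFiniteMeasure μ] :
    Integrable (fun x => f x) μ :=
  f.toBCF.integrable μ

end ZeroAtInfty

/-! ### Vague limits and escape of mass -/

section Vague

variable {X ι : Type*} [TopologicalSpace X] [T2Space X] [MeasurableSpace X] [BorelSpace X]

theorem tendsto_integral_zeroAtInfty_of_compactlySupported {l : Filter ι} {P : ι → Measure X}
    {ν : Measure X} [∀ i, IsProbabilityMeasure (P i)] [IsFiniteMeasure ν]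
    (h : ∀ f : C_c(X, ℝ), Tendsto (fun i => ∫ x, f x ∂(P i)) l (𝓝 (∫ x, f x ∂ν)))
    (f : C₀(X, ℝ)) : Tendsto (fun i => ∫ x, f x ∂(P i)) l (𝓝 (∫ x, f x ∂ν)) := by
  refine tendsto_of_forall_approx fun ε hε => ?_
  -- This bounds the masses of all `P i` and of `ν` at once.
  have hm : 0 < 1 + ν.real Set.univ := by positivity
  obtain ⟨g, hg⟩ := f.exists_compactlySupported_approx (div_pos hε hm)
  have key : ∀ (μ : Measure X) [IsFiniteMeasure μ], μ.real Set.univ ≤ 1 + ν.real Set.univ →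
      ‖∫ x, f x ∂μ - ∫ x, g x ∂μ‖ ≤ ε := by
    intro μ _ hμ
    rw [← integral_sub (integrable_zeroAtInfty f μ) g.integrable]
    refine (norm_integral_le_of_norm_le_const (.of_forall hg)).trans ?_
    calc ε / (1 + ν.real Set.univ) * μ.real Set.univ
        ≤ ε / (1 + ν.real Set.univ) * (1 + ν.real Set.univ) := by gcongr
      _ = ε := div_mul_cancel₀ _ hm.ne'
  exact ⟨_, _, .of_forall fun i => key (P i) (by simp), key ν (by simp), h g⟩

variable [LocallyCompactSpace X]

/-- Vague compactness: along an ultrafilter, probability measures converge vaguely to a finite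
regular measure. -/
theorem exists_vague_limit (u : Ultrafilter ι) (P : ι → Measure X)
    [∀ i, IsProbabilityMeasure (P i)] :
    ∃ ν : Measure X, IsFiniteMeasure ν ∧ ν.Regular ∧
      ∀ f : C₀(X, ℝ), Tendsto (fun i => ∫ x, f x ∂(P i)) u (𝓝 (∫ x, f x ∂ν)) := by
  have hlim : ∀ f : C_c(X, ℝ), ∃ a : ℝ, Tendsto (fun i => ∫ x, f x ∂(P i)) u (𝓝 a) := by
    intro f
    obtain ⟨C, hC⟩ := f.hasCompactSupport.exists_bound_of_continuous f.continuous
    have hmem : ∀ i, (∫ x, f x ∂(P i)) ∈ Metric.closedBall (0 : ℝ) C := fun i => by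
      simpa using norm_integral_le_of_norm_le_const (μ := P i) (.of_forall hC)
    obtain ⟨a, -, ha⟩ := (isCompact_closedBall (0 : ℝ) C).ultrafilter_le_nhds
      (u.map fun i => ∫ x, f x ∂(P i)) (by simpa using! Filter.univ_mem' hmem)
    exact ⟨a, ha⟩
  choose L hL using hlim
  let Λ : C_c(X, ℝ) →ₚ[ℝ] ℝ := PositiveLinearMap.mk₀
    { toFun := L
      map_add' := fun f g => tendsto_nhds_unique (hL (f + g)) <| by
        refine ((hL f).add (hL g)).congr fun i => ?_
        exact (integral_add f.integrable g.integrable).symm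
      map_smul' := fun c f => tendsto_nhds_unique (hL (c • f)) <| by
        refine ((hL f).const_mul c).congr fun i => ?_
        exact (integral_const_mul c _).symm }
    fun f hf => ge_of_tendsto' (hL f) fun i => integral_nonneg hf
  -- Mass may be lost in the limit but not gained: each compact set is dominated by a cutoff whose
  -- integrals are at most one.
  have hmass : RealRMK.rieszMeasure Λ Set.univ ≤ 1 := by
    rw [isOpen_univ.measure_eq_iSup_isCompact]
    refine iSup₂_le fun K _ => iSup_le fun hK => ?_
    obtain ⟨φ, hφ1, hφ⟩ := exists_compactlySupported_eq_one_on hK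
    refine (RealRMK.rieszMeasure_le_of_eq_one Λ (fun x => (hφ x).1) hK hφ1).trans ?_
    rw [ENNReal.ofReal_le_one]
    refine le_of_tendsto' (hL φ) fun i => ?_
    calc ∫ x, φ x ∂(P i) ≤ ∫ _, (1 : ℝ) ∂(P i) :=
          integral_mono φ.integrable (integrable_const _) fun x => (hφ x).2
      _ = 1 := by simp
  have hfin : IsFiniteMeasure (RealRMK.rieszMeasure Λ) := ⟨hmass.trans_lt ENNReal.one_lt_top⟩
  refine ⟨RealRMK.rieszMeasure Λ, hfin, inferInstance,
    tendsto_integral_zeroAtInfty_of_compactlySupported fun f => ?_⟩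
  rw [RealRMK.integral_rieszMeasure]
  exact hL f

/-- When no mass escapes to infinity, convergence of the integrals of a bounded function can be
tested after multiplication by compactly supported cutoffs. -/
theorem tendsto_integral_of_cutoff {E : Type*} [NormedAddCommGroup E] [NormedSpace ℝ E]
    {l : Filter ι} {P : ι → Measure X} {Q : Measure X} [∀ i, IsProbabilityMeasure (P i)]
    [IsProbabilityMeasure Q] [Q.Regular]
    (h : ∀ f : C_c(X, ℝ), Tendsto (fun i => ∫ x, f x ∂(P i)) l (𝓝 (∫ x, f x ∂Q)))
    {F : X → E} {C : ℝ} (hC : ∀ x, ‖F x‖ ≤ C) (hFP : ∀ i, Integrable F (P i))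
    (hFQ : Integrable F Q)
    (hF : ∀ φ : C_c(X, ℝ), Tendsto (fun i => ∫ x, φ x • F x ∂(P i)) l (𝓝 (∫ x, φ x • F x ∂Q))) :
    Tendsto (fun i => ∫ x, F x ∂(P i)) l (𝓝 (∫ x, F x ∂Q)) := by
  refine tendsto_of_forall_approx fun ε hε => ?_
  have hX : Nonempty X := Q.nonempty_of_neZero
  have hC0 : 0 ≤ C := (norm_nonneg _).trans (hC hX.some)
  -- The `+ 1` covers `C = 0`.
  set δ : ℝ := ε / (C + 1) with hδ
  have hδ0 : 0 < δ := by positivity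
  have hCδ : C * δ ≤ ε := by
    rw [hδ, mul_div_assoc', div_le_iff₀ (by positivity)]
    nlinarith
  obtain ⟨K, -, hK, hQK⟩ := (MeasurableSet.univ (α := X)).exists_isCompact_lt_add (μ := Q)
    (measure_ne_top Q _) (ENNReal.ofReal_pos.2 hδ0).ne'
  obtain ⟨φ, hφ1, hφ⟩ := exists_compactlySupported_eq_one_on hK
  have hφQ : 1 - δ < ∫ x, φ x ∂Q := by
    have h1 : 1 < Q.real K + δ := by
      have := ENNReal.toReal_strict_mono (by finiteness) hQK
      rwa [ENNReal.toReal_add (by finiteness) (by finiteness), ENNReal.toReal_ofReal hδ0.le,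
        measure_univ, ENNReal.toReal_one] at this
    have h2 : Q.real K ≤ ∫ x, φ x ∂Q := by
      rw [← integral_indicator_one hK.measurableSet]
      refine integral_mono ((integrable_const (1 : ℝ)).indicator hK.measurableSet) φ.integrable
        fun x => ?_
      by_cases hx : x ∈ K
      · simp [hx, hφ1 x hx]
      · simpa [hx] using (hφ x).1
    linarith
  have key : ∀ (μ : Measure X) [IsProbabilityMeasure μ], Integrable F μ →
      1 - δ < ∫ x, φ x ∂μ → ‖∫ x, F x ∂μ - ∫ x, φ x • F x ∂μ‖ ≤ ε := by
    intro μ _ hFμ hμ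
    have hint : Integrable (fun x => φ x • F x) μ :=
      hFμ.bdd_smul 1 φ.continuous.aestronglyMeasurable
        (.of_forall fun x => by rw [Real.norm_of_nonneg (hφ x).1]; exact (hφ x).2)
    rw [← integral_sub hFμ hint]
    calc ‖∫ x, (F x - φ x • F x) ∂μ‖ ≤ ∫ x, C * (1 - φ x) ∂μ := by
          refine norm_integral_le_of_norm_le
            (((integrable_const _).sub φ.integrable).const_mul C) (.of_forall fun x => ?_)
          have : F x - φ x • F x = (1 - φ x) • F x := by rw [sub_smul, one_smul]
          rw [this, norm_smul, Real.norm_of_nonneg (sub_nonneg.2 (hφ x).2), mul_comm]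
          exact mul_le_mul_of_nonneg_right (hC x) (sub_nonneg.2 (hφ x).2)
      _ = C * (1 - ∫ x, φ x ∂μ) := by
          rw [integral_const_mul, integral_sub (integrable_const _) φ.integrable]
          simp
      _ ≤ C * δ := by gcongr; linarith
      _ ≤ ε := hCδ
  refine ⟨_, _, ?_, key Q hFQ hφQ, hF φ⟩
  filter_upwards [(h φ).eventually_const_lt hφQ] with i hi
  exact key (P i) (hFP i) hi

end Vague

/-- Weak convergence inside a compact set is norm convergence. -/
theorem tendsto_of_forall_inner_of_isCompact {ι H : Type*} [NormedAddCommGroup H]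
    [InnerProductSpace ℝ H] {l : Filter ι} {m : ι → H} {z : H} {S : Set H} (hS : IsCompact S)
    (hm : ∀ i, m i ∈ S)
    (h : ∀ f : H, Tendsto (fun i => inner ℝ f (m i)) l (𝓝 (inner ℝ f z))) :
    Tendsto m l (𝓝 z) := by
  rw [tendsto_iff_ultrafilter]
  intro u hu
  obtain ⟨w, -, hw⟩ := hS.ultrafilter_le_nhds (u.map m) (by simpa using! Filter.univ_mem' hm)
  have hw' : Tendsto m u (𝓝 w) := hw
  have : w = z := ext_inner_left ℝ fun f =>
    tendsto_nhds_unique (tendsto_const_nhds.inner hw') ((h f).mono_left hu)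
  exact this ▸ hw'

/-- A bounded sequence in a Hilbert space that is asymptotically orthogonal to each of its members
converges weakly to zero. -/
theorem tendsto_inner_of_asymptotically_orthogonal {H : Type*} [NormedAddCommGroup H]
    [InnerProductSpace ℝ H] [CompleteSpace H] {w : ℕ → H} {C : ℝ} (hC : ∀ n, ‖w n‖ ≤ C)
    (hw : ∀ i, Tendsto (fun n => inner ℝ (w i) (w n)) atTop (𝓝 0)) (f : H) :
    Tendsto (fun n => inner ℝ f (w n)) atTop (𝓝 0) := by
  have hspan : ∀ h ∈ Submodule.span ℝ (Set.range w),
      Tendsto (fun n => inner ℝ h (w n)) atTop (𝓝 0) := by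
    intro h hh
    induction hh using Submodule.span_induction with
    | mem x hx => obtain ⟨i, rfl⟩ := hx; exact hw i
    | zero => simp
    | add x y _ _ hx hy => simpa [inner_add_left] using hx.add hy
    | smul c x _ hx => simpa [inner_smul_left] using hx.const_mul c
  -- Only the projection of `f` to the closed span matters, and it is approximated by finite
  -- combinations because `w` is bounded.
  let S := (Submodule.span ℝ (Set.range w)).topologicalClosure
  have : CompleteSpace S := (Submodule.isClosed_topologicalClosure _).completeSpace_coe
  have hwS : ∀ n, w n ∈ S := fun n =>
    Submodule.le_topologicalClosure _ (Submodule.subset_span ⟨n, rfl⟩)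
  have hproj : ∀ n, inner ℝ f (w n) = inner ℝ (S.starProjection f) (w n) := by
    intro n
    have := (Submodule.mem_orthogonal' S _).1 (S.sub_starProjection_mem_orthogonal f) (w n) (hwS n)
    rwa [inner_sub_left, sub_eq_zero] at this
  have hC0 : 0 ≤ C := (norm_nonneg _).trans (hC 0)
  refine tendsto_of_forall_approx fun ε hε => ?_
  have hmem : S.starProjection f ∈ closure (Submodule.span ℝ (Set.range w) : Set H) :=
    S.starProjection_apply_mem f
  obtain ⟨h, hh, hd⟩ := Metric.mem_closure_iff.1 hmem (ε / (C + 1)) (by positivity)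
  refine ⟨_, 0, .of_forall fun n => ?_, by simpa using hε.le, hspan h hh⟩
  rw [hproj, ← inner_sub_left]
  rw [dist_eq_norm] at hd
  calc ‖inner ℝ (S.starProjection f - h) (w n)‖ ≤ ‖S.starProjection f - h‖ * ‖w n‖ :=
        norm_inner_le_norm _ _
    _ ≤ ε / (C + 1) * (C + 1) := by
        gcongr
        exact (hC n).trans (by linarith)
    _ = ε := div_mul_cancel₀ _ (by positivity)

/-- If `v` is weakly continuous and bounded, and does not tend to `0` at `x₀` although `v x₀ = 0`,
then some sequence in any neighbourhood of `x₀` witnesses this with weak convergence to `0`. -/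
theorem exists_seq_tendsto_inner_zero {X H : Type*} [TopologicalSpace X] [NormedAddCommGroup H]
    [InnerProductSpace ℝ H] [CompleteSpace H] {v : X → H} {x₀ : X} {C ε : ℝ}
    (hC : ∀ x, ‖v x‖ ≤ C)
    (hv : ∀ f : H, Tendsto (fun x => inner ℝ f (v x)) (𝓝 x₀) (𝓝 0))
    (hε : ∃ᶠ x in 𝓝 x₀, ε ≤ ‖v x‖) {K : Set X} (hK : K ∈ 𝓝 x₀) :
    ∃ x : ℕ → X, (∀ n, x n ∈ K) ∧ (∀ n, ε ≤ ‖v (x n)‖) ∧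
      ∀ f : H, Tendsto (fun n => inner ℝ f (v (x n))) atTop (𝓝 0) := by
  -- The first component is a strictly increasing counter, so the orthogonality errors tend to zero.
  obtain ⟨y, hy, hr⟩ := exists_seq_of_forall_finset_exists
    (fun p : ℕ × X => p.2 ∈ K ∧ ε ≤ ‖v p.2‖)
    (fun p q => p.1 < q.1 ∧ |inner ℝ (v p.2) (v q.2)| < 1 / ((q.1 : ℝ) + 1))
    (by
      intro s _
      set N : ℕ := s.sup Prod.fst + 1 with hN
      have hev : ∀ᶠ x in 𝓝 x₀, x ∈ K ∧
          ∀ p ∈ s, |inner ℝ (v p.2) (v x)| < 1 / ((N : ℝ) + 1) := by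
        refine Filter.Eventually.and hK ((Finset.eventually_all s).2 fun p _ => ?_)
        simpa using Metric.tendsto_nhds.1 (hv (v p.2)) (1 / ((N : ℝ) + 1)) (by positivity)
      obtain ⟨x, hx1, hxK, hx2⟩ := (hε.and_eventually hev).exists
      exact ⟨(N, x), ⟨hxK, hx1⟩, fun p hp =>
        ⟨Nat.lt_succ_of_le (Finset.le_sup (f := Prod.fst) hp), hx2 p hp⟩⟩)
  have hmono : StrictMono fun n => (y n).1 := fun m n hmn => (hr m n hmn).1
  refine ⟨fun n => (y n).2, fun n => (hy n).1, fun n => (hy n).2,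
    tendsto_inner_of_asymptotically_orthogonal (fun n => hC _) fun i => ?_⟩
  refine squeeze_zero_norm' ?_ tendsto_one_div_add_atTop_nhds_zero_nat
  filter_upwards [eventually_gt_atTop i] with n hn
  refine (hr i n hn).2.le.trans ?_
  have : (n : ℝ) ≤ (y n).1 := by exact_mod_cast hmono.id_le n
  gcongr

/-! ### Feature map, embeddings and ISPD -/

namespace PDKernel

theorem inner_feature_feature {X : Type*} (k : PDKernel X) (x y : X) :
    inner ℝ (k.feature x) (k.feature y) = k y x := by
  rw [inner_feature, feature_apply]

section Continuity

variable {X : Type*} [TopologicalSpace X] {k : PDKernel X}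

theorem continuous_of_continuous_feature (h : Continuous k.feature) :
    Continuous fun p : X × X => k p.1 p.2 := by
  simp_rw [← inner_feature_feature]
  fun_prop

theorem continuous_feature_of_continuous (h : Continuous fun p : X × X => k p.1 p.2) :
    Continuous k.feature := by
  rw [continuous_iff_continuousAt]
  intro x
  rw [ContinuousAt, tendsto_iff_norm_sub_tendsto_zero]
  have hsq : ∀ y, ‖k.feature y - k.feature x‖ = √(k y y - 2 * k x y + k x x) := by
    intro y
    rw [← Real.sqrt_sq (norm_nonneg (k.feature y - k.feature x)), norm_sub_sq_real,
      inner_feature_feature, ← real_inner_self_eq_norm_sq, ← real_inner_self_eq_norm_sq,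
      inner_feature_feature, inner_feature_feature]
  have h1 : Continuous fun y => k y y := h.comp (continuous_id.prodMk continuous_id)
  have h2 : Continuous fun y => k x y := h.comp (continuous_const.prodMk continuous_id)
  have hc : Continuous fun y => √(k y y - 2 * k x y + k x x) := by fun_prop
  simp_rw [hsq]
  convert hc.tendsto x using 2
  rw [show k x x - 2 * k x x + k x x = 0 by ring, Real.sqrt_zero]

namespace RKHSSubsetC0

theorem continuous (hC0 : k.RKHSSubsetC0) (f : k.Hilbert) : Continuous f := by
  obtain ⟨g, hg⟩ := hC0 f
  rw [← funext hg]
  exact g.continuous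

/-- Every `f` in `H_k` is bounded, so the evaluations are pointwise bounded and Banach–Steinhaus
applies. -/
theorem exists_norm_feature_le (hC0 : k.RKHSSubsetC0) : ∃ C, ∀ x, ‖k.feature x‖ ≤ C := by
  obtain ⟨C, hC⟩ := banach_steinhaus (g := fun x => innerSL ℝ (k.feature x)) fun f => by
    obtain ⟨g, hg⟩ := hC0 f
    refine ⟨‖g.toBCF‖, fun x => ?_⟩
    rw [innerSL_apply_apply, real_inner_comm, inner_feature, ← hg]
    exact g.toBCF.norm_coe_le_norm x
  exact ⟨C, fun x => by simpa using hC x⟩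

end RKHSSubsetC0

end Continuity

section Embedding

variable {X : Type*} [MeasurableSpace X] (k : PDKernel X)

theorem kme_toSignedMeasure (μ : Measure X) [IsFiniteMeasure μ] :
    k.kme μ.toSignedMeasure = ∫ x, k.feature x ∂μ :=
  VectorMeasure.integral_toSignedMeasure

variable {k}

theorem inner_kme {μ : Measure X} [IsFiniteMeasure μ] (h : Integrable k.feature μ)
    (f : k.Hilbert) : inner ℝ f (k.kme μ.toSignedMeasure) = ∫ x, f x ∂μ := by
  rw [kme_toSignedMeasure, ← integral_inner h]
  simp_rw [inner_feature]

end Embedding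

section ISPD

variable {X : Type*} [TopologicalSpace X] [T2Space X] [MeasurableSpace X] [BorelSpace X]
  {k : PDKernel X}

namespace IsISPD

theorem eq_of_kme_eq (hk : k.IsISPD) {μ ν : Measure X} [IsFiniteMeasure μ]
    [IsFiniteMeasure ν] [μ.Regular] [ν.Regular]
    (h : k.kme μ.toSignedMeasure = k.kme ν.toSignedMeasure) : μ = ν :=
  Measure.toSignedMeasure_eq_toSignedMeasure_iff.1 <|
    hk _ _ (Measure.Regular.signedMeasureRegular μ) (Measure.Regular.signedMeasureRegular ν)
      (by rw [mmd, h, sub_self, norm_zero])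

/-- A non-integrable feature map would have Bochner integral `0`, the embedding of the zero measure;
ISPD then gives `μ = 0`, a contradiction. No continuity of `k` is needed. -/
theorem integrable_feature (hk : k.IsISPD) (μ : Measure X) [IsFiniteMeasure μ] [μ.Regular] :
    Integrable k.feature μ := by
  by_contra hμ
  have : μ = 0 := hk.eq_of_kme_eq (by
    rw [kme_toSignedMeasure, kme_toSignedMeasure, integral_undef hμ, integral_zero_measure])
  subst this
  exact hμ integrable_zero_measure

theorem eq_of_forall_integral_eq (hk : k.IsISPD) {μ ν : Measure X} [IsFiniteMeasure μ]
    [IsFiniteMeasure ν] [μ.Regular] [ν.Regular]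
    (h : ∀ f : k.Hilbert, ∫ x, f x ∂μ = ∫ x, f x ∂ν) : μ = ν :=
  hk.eq_of_kme_eq <| ext_inner_left ℝ fun f => by
    rw [inner_kme (hk.integrable_feature μ), inner_kme (hk.integrable_feature ν), h]

theorem feature_injective (hk : k.IsISPD) : Function.Injective k.feature := by
  intro x y hxy
  have := Measure.regular_dirac x
  have := Measure.regular_dirac y
  have h : Measure.dirac x = Measure.dirac y := hk.eq_of_kme_eq (by
    rw [kme_toSignedMeasure, kme_toSignedMeasure, integral_dirac, integral_dirac, hxy])
  by_contra hne
  have h1 := congrArg (fun μ : Measure X => μ {x}) h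
  simp [Ne.symm hne] at h1

end IsISPD

variable {ι : Type*} {l : Filter ι} {P : ι → Measure X} {Q : Measure X}
  [∀ i, IsProbabilityMeasure (P i)] [IsProbabilityMeasure Q] [Q.Regular]

theorem tendsto_integral_of_tendsto_mmd [∀ i, (P i).Regular] (hk : k.IsISPD)
    (h : Tendsto (fun i => k.mmd (P i).toSignedMeasure Q.toSignedMeasure) l (𝓝 0))
    (f : k.Hilbert) : Tendsto (fun i => ∫ x, f x ∂(P i)) l (𝓝 (∫ x, f x ∂Q)) := by
  simp_rw [← fun i => inner_kme (hk.integrable_feature (P i)) f,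
    ← inner_kme (hk.integrable_feature Q) f]
  exact tendsto_const_nhds.inner (tendsto_iff_norm_sub_tendsto_zero.2 h)

variable [LocallyCompactSpace X]

theorem tendsto_integral_zeroAtInfty_of_hilbert (hk : k.IsISPD) (hC0 : k.RKHSSubsetC0)
    (h : ∀ f : k.Hilbert, Tendsto (fun i => ∫ x, f x ∂(P i)) l (𝓝 (∫ x, f x ∂Q)))
    (f : C₀(X, ℝ)) : Tendsto (fun i => ∫ x, f x ∂(P i)) l (𝓝 (∫ x, f x ∂Q)) := by
  rw [tendsto_iff_ultrafilter]
  intro u hu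
  obtain ⟨ν, _, _, hν⟩ := exists_vague_limit u P
  have : ν = Q := hk.eq_of_forall_integral_eq fun g => by
    obtain ⟨g', hg'⟩ := hC0 g
    have h1 := hν g'
    simp_rw [hg'] at h1
    exact tendsto_nhds_unique h1 ((h g).mono_left hu)
  exact this ▸ hν f

theorem tendsto_integral_boundedContinuous_of_zeroAtInfty
    (h : ∀ f : C₀(X, ℝ), Tendsto (fun i => ∫ x, f x ∂(P i)) l (𝓝 (∫ x, f x ∂Q)))
    (f : X →ᵇ ℝ) : Tendsto (fun i => ∫ x, f x ∂(P i)) l (𝓝 (∫ x, f x ∂Q)) := by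
  have hc : ∀ g : C_c(X, ℝ), Tendsto (fun i => ∫ x, g x ∂(P i)) l (𝓝 (∫ x, g x ∂Q)) :=
    fun g => h (g : C₀(X, ℝ))
  refine tendsto_integral_of_cutoff hc f.norm_coe_le_norm (fun i => f.integrable _)
    (f.integrable _) fun φ => ?_
  exact hc ⟨⟨fun x => φ x * f x, by fun_prop⟩, φ.hasCompactSupport.mul_right⟩

theorem tendsto_mmd_of_zeroAtInfty [∀ i, (P i).Regular] (hk : k.IsISPD) (hC0 : k.RKHSSubsetC0)
    (hcont : Continuous fun p : X × X => k p.1 p.2)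
    (h : ∀ f : C₀(X, ℝ), Tendsto (fun i => ∫ x, f x ∂(P i)) l (𝓝 (∫ x, f x ∂Q))) :
    Tendsto (fun i => k.mmd (P i).toSignedMeasure Q.toSignedMeasure) l (𝓝 0) := by
  have hc : ∀ g : C_c(X, ℝ), Tendsto (fun i => ∫ x, g x ∂(P i)) l (𝓝 (∫ x, g x ∂Q)) :=
    fun g => h (g : C₀(X, ℝ))
  have hfeat := continuous_feature_of_continuous hcont
  obtain ⟨C, hC⟩ := hC0.exists_norm_feature_le
  suffices hlim : Tendsto (fun i => k.kme (P i).toSignedMeasure) l (𝓝 (k.kme Q.toSignedMeasure))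
    from tendsto_iff_norm_sub_tendsto_zero.1 hlim
  simp_rw [kme_toSignedMeasure]
  refine tendsto_integral_of_cutoff hc hC (fun i => hk.integrable_feature (P i))
    (hk.integrable_feature Q) fun φ => ?_
  have hint : ∀ (μ : Measure X) [IsProbabilityMeasure μ] [μ.Regular],
      Integrable (fun x => φ x • k.feature x) μ := by
    intro μ _ _
    obtain ⟨B, hB⟩ := φ.hasCompactSupport.exists_bound_of_continuous φ.continuous
    exact (hk.integrable_feature μ).bdd_smul B φ.continuous.aestronglyMeasurable (.of_forall hB)
  have hinner : ∀ (μ : Measure X) [IsProbabilityMeasure μ] [μ.Regular] (f : k.Hilbert),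
      inner ℝ f (∫ x, φ x • k.feature x ∂μ) = ∫ x, φ x * f x ∂μ := by
    intro μ _ _ f
    rw [← integral_inner (hint μ)]
    simp_rw [inner_smul_right, inner_feature]
  -- By completeness the closed convex hull of this range is compact, and it contains the integrals
  -- against all `P i`.
  have hrange : TotallyBounded (Set.range fun x => φ x • k.feature x) :=
    (HasCompactSupport.isCompact_range (φ.hasCompactSupport.smul_right)
      (φ.continuous.smul hfeat)).totallyBounded
  refine tendsto_of_forall_inner_of_isCompact
    (hrange.convexHull.closure.isCompact_of_isClosed isClosed_closure)
    (fun i => (convex_convexHull ℝ _).closure.integral_mem isClosed_closure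
      (.of_forall fun x => subset_closure (subset_convexHull ℝ _ ⟨x, rfl⟩)) (hint (P i)))
    fun f => ?_
  simp_rw [hinner]
  have hf := hC0.continuous f
  exact hc ⟨⟨fun x => φ x * f x, by fun_prop⟩, φ.hasCompactSupport.mul_right⟩

theorem continuous_feature_of_sequential (hk : k.IsISPD) (hC0 : k.RKHSSubsetC0)
    (h : ∀ (x : ℕ → X) (x₀ : X), Tendsto x atTop (𝓝 x₀) →
      Tendsto (fun n => k.feature (x n)) atTop (𝓝 (k.feature x₀))) :
    Continuous k.feature := by
  rw [continuous_iff_continuousAt]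
  intro x₀
  by_contra hx₀
  obtain ⟨C, hC⟩ := hC0.exists_norm_feature_le
  obtain ⟨ε, hε, hfreq⟩ : ∃ ε > 0, ∃ᶠ x in 𝓝 x₀, ε ≤ ‖k.feature x - k.feature x₀‖ := by
    rw [ContinuousAt, Metric.tendsto_nhds] at hx₀
    push Not at hx₀
    simpa [dist_eq_norm] using hx₀
  have hinner : ∀ (f : k.Hilbert) (x : X),
      inner ℝ f (k.feature x - k.feature x₀) = f x - f x₀ := fun f x => by
    rw [inner_sub_right, inner_feature, inner_feature]
  obtain ⟨K, hK, hKx⟩ := exists_compact_mem_nhds x₀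
  obtain ⟨x, hxK, hxε, hx⟩ := exists_seq_tendsto_inner_zero
    (v := fun x => k.feature x - k.feature x₀) (C := C + C)
    (fun x => (norm_sub_le _ _).trans (add_le_add (hC _) (hC _)))
    (fun f => by
      simp_rw [hinner]
      simpa using ((hC0.continuous f).tendsto x₀).sub_const (f x₀)) hfreq hKx
  -- Any ultrafilter limit `y` in `K` satisfies `f y = f x₀` for all `f` in `H_k`, so it is `x₀`.
  have hxlim : Tendsto x atTop (𝓝 x₀) := by
    rw [tendsto_iff_ultrafilter]
    intro u hu
    obtain ⟨y, -, hy⟩ := hK.ultrafilter_le_nhds (u.map x) (by simpa using! Filter.univ_mem' hxK)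
    have hy' : Tendsto x u (𝓝 y) := hy
    have : y = x₀ := hk.feature_injective <| ext_inner_left ℝ fun f => by
      rw [inner_feature, inner_feature, ← sub_eq_zero]
      have h1 := (hx f).mono_left hu
      simp_rw [hinner] at h1
      exact tendsto_nhds_unique
        ((((hC0.continuous f).tendsto y).comp hy').sub_const (f x₀)) h1
    exact this ▸ hy'
  have := tendsto_iff_norm_sub_tendsto_zero.1 (h x x₀ hxlim)
  exact absurd (ge_of_tendsto' this hxε) (not_le.2 hε)

end ISPD

end PDKernel

theorem mainTheorem2 {X : Type*} [TopologicalSpace X] [T2Space X] [LocallyCompactSpace X]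
    [MeasurableSpace X] [BorelSpace X]
    (k : PDKernel X) (hispd : k.IsISPD) (hC0 : k.RKHSSubsetC0) :
    -- if `k` is continuous, the four modes of convergence are equivalent
    (Continuous (fun p : X × X => k p.1 p.2) →
      ∀ (ι : Type*) (l : Filter ι) (P : ι → Measure X) (Q : Measure X)
        [∀ i, IsProbabilityMeasure (P i)] [∀ i, (P i).Regular]
        [IsProbabilityMeasure Q] [Q.Regular],
        List.TFAE [
          Tendsto (fun i => k.mmd (P i).toSignedMeasure Q.toSignedMeasure) l (𝓝 0),
          ∀ f : k.Hilbert, Tendsto (fun i => ∫ x, f x ∂(P i)) l (𝓝 (∫ x, f x ∂Q)),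
          ∀ f : C₀(X, ℝ), Tendsto (fun i => ∫ x, f x ∂(P i)) l (𝓝 (∫ x, f x ∂Q)),
          ∀ f : X →ᵇ ℝ, Tendsto (fun i => ∫ x, f x ∂(P i)) l (𝓝 (∫ x, f x ∂Q))]) ∧
    -- conversely, if weak convergence implies MMD convergence (already along sequences),
    -- then `k` is continuous
    ((∀ (P : ℕ → Measure X) (Q : Measure X)
        [∀ n, IsProbabilityMeasure (P n)] [∀ n, (P n).Regular]
        [IsProbabilityMeasure Q] [Q.Regular],
        (∀ f : X →ᵇ ℝ, Tendsto (fun n => ∫ x, f x ∂(P n)) atTop (𝓝 (∫ x, f x ∂Q))) →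
        Tendsto (fun n => k.mmd (P n).toSignedMeasure Q.toSignedMeasure) atTop (𝓝 0)) →
      Continuous (fun p : X × X => k p.1 p.2)) := by 
  refine ⟨fun hcont ι l P Q _ _ _ _ => ?_, fun h => ?_⟩
  · tfae_have 1 → 2 := PDKernel.tendsto_integral_of_tendsto_mmd hispd
    tfae_have 2 → 3 := PDKernel.tendsto_integral_zeroAtInfty_of_hilbert hispd hC0
    tfae_have 3 → 4 := PDKernel.tendsto_integral_boundedContinuous_of_zeroAtInfty
    tfae_have 4 → 3 := fun h f => h f.toBCF
    tfae_have 3 → 1 := PDKernel.tendsto_mmd_of_zeroAtInfty hispd hC0 hcont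
    tfae_finish
  · refine PDKernel.continuous_of_continuous_feature
      (PDKernel.continuous_feature_of_sequential hispd hC0 fun x x₀ hx => ?_)
    have hreg : ∀ y : X, (Measure.dirac y).Regular := Measure.regular_dirac
    have hmmd := h (fun n => Measure.dirac (x n)) (Measure.dirac x₀) fun f => by
      simp_rw [integral_dirac]
      exact (f.continuous.tendsto x₀).comp hx
    rw [tendsto_iff_norm_sub_tendsto_zero]
    simpa only [PDKernel.mmd, PDKernel.kme_toSignedMeasure, integral_dirac] using hmmd
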